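/- All groups are finite and $\mathrm{Irr}(G)$ denotes the set of irreducible complex characters of $G$. A group $G$ is a $CD1$-group if $|G|>2$ and some two columns of the character table of $G$ differ by exactly one entry. In a $CD1$-group one of the two columns is that of the identity class; let the other one be that of the class of $b$, let $\chi_k$ be the unique irreducible character with $\chi_k(b)\neq\chi_k(1)$, and put $a_k=\chi_k(1)$, $b_k=\chi_k(b)$. A $CD1$-group is called extreme if $b_k=-1$ or $b_k=-a_k$. A group $G$ is of central type if $[G:Z(G)]=\chi(1)^2$ for some $\chi\in\mathrm{Irr}(G)$. A Frobenius group with complement $H$ and kernel $F$ is called doubly transitive if $|H|=|F|-1$. **Theorem 1.** A finite group $G$ is an extreme $CD1$-group if and only if one of the following holds: 1. $G$ is a $2$-group of central type with $|Z(G)|=2$ and $|G|>2$; 2. $G$ is a doubly transitive Frobenius group. Moreover, in any $CD1$-group $G$, condition (1) holds if and only if $b_k=-a_k$, and condition (2) holds if and only if $b_k=-1$. -/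

import Mathlib

/-- The set `Irr(G)` of irreducible complex characters of `G`. -/
def irrCharacters (G : Type*) [Group G] : Set (G → ℂ) :=
  {χ | ∃ (n : ℕ) (ρ : Representation ℂ G (Fin n → ℂ)), ρ.IsIrreducible ∧ ρ.character = χ}

/-- The columns of the character table of `G` belonging to the classes of `a` and `b` differ in
the row of the irreducible character `χ`, and in no other row. -/
def ColumnsDifferOnlyAt {G : Type*} [Group G] (χ : G → ℂ) (a b : G) : Prop :=
  χ ∈ irrCharacters G ∧ χ a ≠ χ b ∧ ∀ ψ ∈ irrCharacters G, ψ ≠ χ → ψ a = ψ b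

/-- `CD1`-groups: groups of order greater than `2` in whose character table some two columns
differ by exactly one entry. -/
def IsCD1Group (G : Type*) [Group G] : Prop :=
  2 < Nat.card G ∧ ∃ (a b : G) (χ : G → ℂ), ColumnsDifferOnlyAt χ a b

/-- Extreme `CD1`-groups: with `χ` the exceptional irreducible character and `b` in the
exceptional non-unit class (so that the columns of `1` and of `b` differ only at `χ`), either
`χ(b) = -1` or `χ(b) = -χ(1)`. -/
def IsExtremeCD1Group (G : Type*) [Group G] : Prop :=
  IsCD1Group G ∧ ∃ (χ : G → ℂ) (b : G), ColumnsDifferOnlyAt χ 1 b ∧ (χ b = -1 ∨ χ b = -χ 1)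

/-- Groups of central type: `[G : Z(G)] = χ(1)²` for some irreducible character `χ`. -/
def IsCentralType (G : Type*) [Group G] : Prop :=
  ∃ χ ∈ irrCharacters G, ((Subgroup.center G).index : ℂ) = χ 1 ^ 2

/-- Frobenius complements: non-trivial proper subgroups `H` of `G` which meet each of their
conjugates by elements outside `H` trivially. -/
def IsFrobeniusComplement {G : Type*} [Group G] (H : Subgroup G) : Prop :=
  H ≠ ⊥ ∧ H ≠ ⊤ ∧ ∀ g, g ∉ H → ∀ x ∈ H, g * x * g⁻¹ ∈ H → x = 1

/-- The Frobenius kernel belonging to a Frobenius complement `H`, as a set: the identity together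
with all the elements which lie in no conjugate of `H`. -/
def frobeniusKernel {G : Type*} [Group G] (H : Subgroup G) : Set G :=
  {x | x = 1 ∨ ∀ g : G, g * x * g⁻¹ ∉ H}

/-- Doubly transitive Frobenius groups: Frobenius groups with a complement `H` and kernel `F`
such that `|H| = |F| - 1`. -/
def IsDoublyTransitiveFrobenius (G : Type*) [Group G] : Prop :=
  ∃ H : Subgroup G, IsFrobeniusComplement H ∧ Nat.card H + 1 = Nat.card (frobeniusKernel H)

/-- `2`-groups of central type, of order greater than `2`, with centre of order `2`. -/
def IsTwoGroupOfCentralType (G : Type*) [Group G] : Prop :=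
  2 < Nat.card G ∧ IsPGroup 2 G ∧ IsCentralType G ∧ Nat.card (Subgroup.center G) = 2

/-! Completeness of the irreducible characters carries everything. If the columns of `1` and `b`
differ only at `χ`, and `k` is the size of the class of `b`, then `k (χ 1 - χ b) conj χ` and `|G| (k
δ_1 - 1_{cl b})` pair equally with every irreducible character, so they coincide
(`ColumnsDifferOnlyAt.mul_star_eq`). Hence `χ` vanishes off `1` and the class of `b`, `χ 1 (χ 1 - χ
b) = |G|` and `k χ(b) = -χ(1)`; moreover `χ` and the class of `b` are determined by `G`.

If `χ b = -χ 1`, then `k = 1` and `b` is central. By Schur's lemma `χ` has no zeros on the centre,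
so the centre is `{1, b}` of index `χ(1)²`; integrality on Sylow subgroups rules out odd primes.
Conversely, the norm of `χ` forces it to vanish off the centre, and orthogonality to `χ` makes all
other characters agree at the two central elements.

If `χ b = -1`, then with `a = χ 1` the identity and the class of `b` form a normal subgroup of order
`a + 1` and index `a`. A Schur-Zassenhaus complement acts freely on its nontrivial elements because
centralizers there have order `a + 1`. Conversely, `IsFrobeniusComplement.character_values` shows
that orthogonality and the norm leave one possible character that separates `1` from the rest of the
kernel. The kernel is only counted as a set, so Frobenius's theorem that it is a subgroup is not
needed. -/

open Representation Matrix

/-! ### Transport of representations and unitarity -/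

/-- An equivalence of representations transports irreducibility. -/
theorem Representation.Equiv.isIrreducible {G V W : Type*} [Group G] [AddCommGroup V]
    [Module ℂ V] [AddCommGroup W] [Module ℂ W] {ρ : Representation ℂ G V}
    {σ : Representation ℂ G W} (e : ρ.Equiv σ) [ρ.IsIrreducible] : σ.IsIrreducible := by
  have hρ := (irreducible_iff_isSimpleModule_asModule ρ).1 inferInstance
  rw [irreducible_iff_isSimpleModule_asModule]
  let f := IntertwiningMap.equivLinearMapAsModule ρ σ e.toIntertwiningMap
  have hf : Function.Bijective f := e.toLinearEquiv.bijective
  exact IsSimpleModule.congr (LinearEquiv.ofBijective f hf).symm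

/-- A basis moves the representation to coordinate space, the only kind of space that
`irrCharacters` admits. -/
theorem character_mem_irrCharacters {G V : Type*} [Group G] [AddCommGroup V] [Module ℂ V]
    [FiniteDimensional ℂ V] (ρ : Representation ℂ G V) [ρ.IsIrreducible] :
    ρ.character ∈ irrCharacters G := by
  let e : V ≃ₗ[ℂ] (Fin (Module.finrank ℂ V) → ℂ) := (Module.finBasis ℂ V).equivFun
  let σ : Representation ℂ G (Fin (Module.finrank ℂ V) → ℂ) :=
    { toFun := fun g => e.conj (ρ g)
      map_one' := by ext; simp
      map_mul' := fun x y => by rw [map_mul, Module.End.mul_eq_comp, LinearEquiv.conj_comp]; rfl }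
  let φ : ρ.Equiv σ := .mk e fun g => by ext; simp [σ, LinearEquiv.conj_apply]
  exact ⟨_, σ, φ.isIrreducible, (char_iso φ).symm⟩

open scoped ComplexOrder MatrixOrder Matrix.Norms.L2Operator in
/-- A complex matrix representation of a finite group is similar to a unitary one. -/
theorem exists_conj_unitary {G : Type*} [Group G] [Finite G] {n : ℕ}
    (A : G →* Matrix (Fin n) (Fin n) ℂ) :
    ∃ B C : Matrix (Fin n) (Fin n) ℂ, C * B = 1 ∧
      ∀ g, (B * A g * C)ᴴ * (B * A g * C) = 1 := by
  have := Fintype.ofFinite G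
  -- The averaged Hermitian form; writing it as `Bᴴ * B` gives the change of basis.
  let P : Matrix (Fin n) (Fin n) ℂ := ∑ g, (A g)ᴴ * A g
  have hP : P.PosDef := by
    classical
    have h1 : P = 1 + ∑ g ∈ Finset.univ.erase (1 : G), (A g)ᴴ * A g := by
      simp only [P]
      rw [← Finset.add_sum_erase _ _ (Finset.mem_univ (1 : G))]
      simp
    rw [h1]
    exact Matrix.PosDef.one.add_posSemidef
      (Matrix.posSemidef_sum _ fun g _ => posSemidef_conjTranspose_mul_self (A g))
  have hinv : ∀ g, (A g)ᴴ * P * A g = P := by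
    intro g
    simp only [P, Finset.mul_sum, Finset.sum_mul]
    refine Fintype.sum_equiv (_root_.Equiv.mulRight g) _ _ fun x => ?_
    simp [Matrix.mul_assoc]
  obtain ⟨B, hB, hPB⟩ := CStarAlgebra.isStrictlyPositive_iff_eq_star_mul_self.1 hP.isStrictlyPositive
  obtain ⟨C, hBC, hCB⟩ := isUnit_iff_exists.1 hB
  refine ⟨B, C, hCB, fun g => ?_⟩
  have h := hinv g
  rw [hPB, star_eq_conjTranspose] at h
  calc _ = Cᴴ * ((A g)ᴴ * (Bᴴ * B) * A g) * C := by
        simp only [conjTranspose_mul, Matrix.mul_assoc]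
    _ = (B * C)ᴴ * (B * C) := by rw [h]; simp only [conjTranspose_mul, Matrix.mul_assoc]
    _ = 1 := by rw [hBC, conjTranspose_one, Matrix.mul_one]

/-- For a representation on column vectors, each group element acts by a matrix similar to a
unitary one. -/
theorem exists_similar_unitary {G : Type*} [Group G] [Finite G] {n : ℕ}
    (ρ : Representation ℂ G (Fin n → ℂ)) (g : G) :
    ∃ B C U : Matrix (Fin n) (Fin n) ℂ, C * B = 1 ∧ Uᴴ * U = 1 ∧
      LinearMap.toMatrix' (ρ g) = C * U * B := by
  let A : G →* Matrix (Fin n) (Fin n) ℂ :=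
    { toFun := fun g => LinearMap.toMatrix' (ρ g)
      map_one' := by simp [Module.End.one_eq_id]
      map_mul' := fun x y => by rw [map_mul, LinearMap.toMatrix'_mul] }
  obtain ⟨B, C, hCB, h⟩ := exists_conj_unitary A
  refine ⟨B, C, B * A g * C, hCB, h g, ?_⟩
  calc LinearMap.toMatrix' (ρ g) = (C * B) * A g * (C * B) := by simp [hCB, A]
    _ = _ := by simp only [Matrix.mul_assoc]

theorem character_eq_trace_toMatrix' {G : Type*} [Group G] {n : ℕ}
    (ρ : Representation ℂ G (Fin n → ℂ)) (g : G) :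
    ρ.character g = (LinearMap.toMatrix' (ρ g)).trace := by
  rw [character, LinearMap.trace_eq_matrix_trace ℂ (Pi.basisFun ℂ (Fin n)),
    LinearMap.toMatrix_eq_toMatrix']

theorem trace_conj_of_mul_eq_one {n : ℕ} {B C : Matrix (Fin n) (Fin n) ℂ} (h : C * B = 1)
    (U : Matrix (Fin n) (Fin n) ℂ) : (C * U * B).trace = U.trace := by
  rw [Matrix.mul_assoc, Matrix.trace_mul_comm, Matrix.mul_assoc, mul_eq_one_comm.1 h,
    Matrix.mul_one]

theorem character_inv_eq_star {G : Type*} [Group G] [Finite G] {n : ℕ}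
    (ρ : Representation ℂ G (Fin n → ℂ)) (g : G) :
    ρ.character g⁻¹ = star (ρ.character g) := by
  obtain ⟨B, C, U, hCB, hU, hA⟩ := exists_similar_unitary ρ g
  have hBC := mul_eq_one_comm.1 hCB
  have hinv : LinearMap.toMatrix' (ρ g⁻¹) = C * Uᴴ * B := by
    have h1 : LinearMap.toMatrix' (ρ g⁻¹) * LinearMap.toMatrix' (ρ g) = 1 := by
      rw [← LinearMap.toMatrix'_mul, ← map_mul]
      simp [Module.End.one_eq_id]
    have h2 : (C * Uᴴ * B) * LinearMap.toMatrix' (ρ g) = 1 := by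
      calc _ = C * (Uᴴ * (B * C) * U) * B := by rw [hA]; simp only [Matrix.mul_assoc]
        _ = 1 := by rw [hBC, Matrix.mul_one, hU, Matrix.mul_one, hCB]
    have h3 := mul_eq_one_comm.1 h1
    rw [← Matrix.mul_one (LinearMap.toMatrix' (ρ g⁻¹)), ← mul_eq_one_comm.1 h2, ← Matrix.mul_assoc,
      h1, Matrix.one_mul]
  rw [character_eq_trace_toMatrix', character_eq_trace_toMatrix', hinv, hA,
    trace_conj_of_mul_eq_one hCB, trace_conj_of_mul_eq_one hCB, trace_conjTranspose]

open scoped ComplexOrder in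
/-- An element at which a character takes its degree as value acts trivially. -/
theorem apply_eq_one_of_character_eq {G : Type*} [Group G] [Finite G] {n : ℕ}
    (ρ : Representation ℂ G (Fin n → ℂ)) (g : G) (h : ρ.character g = ρ.character 1) :
    ρ g = 1 := by
  obtain ⟨B, C, U, hCB, hU, hA⟩ := exists_similar_unitary ρ g
  have htr : U.trace = n := by
    rw [← trace_conj_of_mul_eq_one hCB, ← hA, ← character_eq_trace_toMatrix', h]
    simp
  -- For unitary `U` the squared Hilbert-Schmidt distance to `1` is `2n - 2 Re (tr U)`.
  have h0 : ((U - 1)ᴴ * (U - 1)).trace = 0 := by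
    have : (U - 1)ᴴ * (U - 1) = 1 - U - Uᴴ + 1 := by
      rw [conjTranspose_sub, Matrix.sub_mul, Matrix.mul_sub, Matrix.mul_sub, hU]
      simp only [conjTranspose_one, Matrix.mul_one, Matrix.one_mul]
      abel
    rw [this, trace_add, trace_sub, trace_sub, trace_conjTranspose, htr]
    simp
  have hU1 : U = 1 := sub_eq_zero.1 (trace_conjTranspose_mul_self_eq_zero_iff.1 h0)
  have : LinearMap.toMatrix' (ρ g) = LinearMap.toMatrix' (1 : Module.End ℂ (Fin n → ℂ)) := by
    rw [hA, hU1, Matrix.mul_one, hCB, Module.End.one_eq_id, LinearMap.toMatrix'_id]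
  exact LinearMap.toMatrix'.injective this

/-! ### Orthogonality, Schur's lemma and completeness -/

section IrreducibleCharacters

variable {G : Type*} [Group G] {χ ψ : G → ℂ}

theorem irrCharacters_conj (hχ : χ ∈ irrCharacters G) (g h : G) : χ (h * g * h⁻¹) = χ g := by
  obtain ⟨n, ρ, -, rfl⟩ := hχ
  exact char_conj ρ g h

theorem irrCharacters_of_isConj (hχ : χ ∈ irrCharacters G) {x y : G} (h : IsConj x y) :
    χ x = χ y := by
  obtain ⟨c, rfl⟩ := isConj_iff.1 h
  exact (irrCharacters_conj hχ x c).symm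

theorem irrCharacters_exists_degree (hχ : χ ∈ irrCharacters G) :
    ∃ n : ℕ, 0 < n ∧ χ 1 = n := by
  obtain ⟨n, ρ, hρ, rfl⟩ := hχ
  refine ⟨n, Nat.pos_of_ne_zero ?_, by simp⟩
  rintro rfl
  obtain ⟨x, y, hxy⟩ := hρ.toNontrivial
  exact hxy (Subrepresentation.toSubmodule_injective (Subsingleton.elim _ _))

theorem irrCharacters_inv [Finite G] (hχ : χ ∈ irrCharacters G) (g : G) :
    χ g⁻¹ = star (χ g) := by
  obtain ⟨n, ρ, -, rfl⟩ := hχ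
  exact character_inv_eq_star ρ g

theorem one_mem_irrCharacters : (fun _ => 1 : G → ℂ) ∈ irrCharacters G := by
  let σ := Representation.trivial ℂ G ℂ
  have : σ.IsIrreducible :=
    { exists_pair_ne := ⟨⊥, ⊤, fun h => bot_ne_top (α := Submodule ℂ ℂ)
        (congrArg Subrepresentation.toSubmodule h)⟩
      eq_bot_or_eq_top := fun s => (eq_bot_or_eq_top s.toSubmodule).imp
        (fun h => Subrepresentation.toSubmodule_injective h)
        (fun h => Subrepresentation.toSubmodule_injective h) }
  convert character_mem_irrCharacters σ using 1
  ext g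
  simp [character, σ]

theorem irrCharacters_mul_eq_degree [Finite G] (hχ : χ ∈ irrCharacters G) {x y : G}
    (hx : χ x = χ 1) (hy : χ y = χ 1) : χ (x * y) = χ 1 := by
  obtain ⟨n, ρ, -, rfl⟩ := hχ
  rw [character, map_mul, apply_eq_one_of_character_eq ρ x hx,
    apply_eq_one_of_character_eq ρ y hy, character, map_one, one_mul]

theorem irrCharacters_sum_mul_star [Fintype G] (hχ : χ ∈ irrCharacters G)
    (hψ : ψ ∈ irrCharacters G) (h : χ ≠ ψ) : ∑ g, χ g * star (ψ g) = 0 := by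
  have hcard : (Nat.card G : ℂ) ≠ 0 := Nat.cast_ne_zero.2 Nat.card_pos.ne'
  have := invertibleOfNonzero hcard
  simp_rw [← irrCharacters_inv hψ]
  obtain ⟨n, ρ, hρ, rfl⟩ := hχ
  obtain ⟨m, σ, hσ, rfl⟩ := hψ
  have := char_orthonormal ρ σ
  rw [if_neg fun ⟨e⟩ => h (char_iso e).symm] at this
  simpa [hcard] using this

theorem irrCharacters_sum_mul_star_self [Fintype G] (hχ : χ ∈ irrCharacters G) :
    ∑ g, χ g * star (χ g) = Nat.card G := by
  have hcard : (Nat.card G : ℂ) ≠ 0 := Nat.cast_ne_zero.2 Nat.card_pos.ne'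
  have := invertibleOfNonzero hcard
  simp_rw [← irrCharacters_inv hχ]
  obtain ⟨n, ρ, hρ, rfl⟩ := hχ
  have := char_orthonormal ρ ρ
  rw [if_pos ⟨Representation.Equiv.refl ρ⟩, inv_mul_eq_iff_eq_mul₀ hcard] at this
  simpa using this

/-- Here `m` is the dimension of the space of `H`-fixed vectors. -/
theorem irrCharacters_sum_subgroup [Finite G] (hχ : χ ∈ irrCharacters G) (H : Subgroup G)
    [Fintype H] : ∃ m : ℕ, ∑ h : H, χ h = Nat.card H * m := by
  have hcard : (Nat.card H : ℂ) ≠ 0 := Nat.cast_ne_zero.2 Nat.card_pos.ne'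
  have := invertibleOfNonzero hcard
  obtain ⟨n, ρ, -, rfl⟩ := hχ
  refine ⟨_, ((inv_mul_eq_iff_eq_mul₀ hcard).1
    (card_inv_mul_sum_char_eq_finrank (ρ.comp H.subtype)))⟩

/-- Schur's lemma, for a central element. -/
theorem irrCharacters_center (hχ : χ ∈ irrCharacters G) {z : G}
    (hz : z ∈ Subgroup.center G) : ∃ c : ℂ, χ z = c * χ 1 ∧ ∀ k : ℕ, χ (z ^ k) = c ^ k * χ 1 := by
  obtain ⟨n, ρ, hρ, rfl⟩ := hχ
  let f : IntertwiningMap ρ ρ := IntertwiningMap.centralMul ρ z (by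
    rw [Submonoid.mem_center_iff]; exact Subgroup.mem_center_iff.1 hz)
  obtain ⟨c, hc⟩ := (IsIrreducible.algebraMap_intertwiningMap_bijective_of_isAlgClosed
    (ρ := ρ)).2 f
  have hρz : ρ z = c • 1 := by
    ext1 i
    have := congrArg (fun f : IntertwiningMap ρ ρ => f.toLinearMap) hc
    rw [IntertwiningMap.algebraMap_apply] at this
    exact congrArg (fun f : Module.End ℂ (Fin n → ℂ) => f ∘ₗ _) this.symm
  have h : ∀ k : ℕ, ρ.character (z ^ k) = c ^ k * ρ.character 1 := by
    intro k
    simp [character, map_pow, hρz, _root_.smul_pow]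
  exact ⟨c, by simpa using h 1, h⟩

/-- An irreducible subrepresentation sits inside every nonzero subrepresentation. -/
theorem exists_irreducible_le {V : Type*} [AddCommGroup V] [Module ℂ V] [FiniteDimensional ℂ V]
    {ρ : Representation ℂ G V} (K : Subrepresentation ρ) (hK : K ≠ ⊥) :
    ∃ A : Subrepresentation ρ, A ≤ K ∧ A.toRepresentation.IsIrreducible := by
  have hwf : WellFounded fun A B : Subrepresentation ρ =>
      A.toSubmodule < B.toSubmodule := InvImage.wf _ wellFounded_lt
  obtain ⟨A, ⟨hAK, hA⟩, hmin⟩ := hwf.has_min {A | A ≤ K ∧ A ≠ ⊥} ⟨K, le_rfl, hK⟩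
  refine ⟨A, hAK, { exists_pair_ne := ⟨⊥, ⊤, fun h => ?_⟩, eq_bot_or_eq_top := fun s => ?_ }⟩
  · have h' : (⊥ : Submodule ℂ A.toSubmodule) = ⊤ := congrArg Subrepresentation.toSubmodule h
    refine hA (Subrepresentation.toSubmodule_injective ?_)
    rw [← A.toSubmodule.map_subtype_top, ← h', Submodule.map_bot]
    rfl
  · let S : Subrepresentation ρ := ⟨s.toSubmodule.map A.toSubmodule.subtype, by
      rintro g _ ⟨x, hx, rfl⟩
      exact ⟨_, s.apply_mem_toSubmodule g hx, rfl⟩⟩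
    have hSA : S.toSubmodule ≤ A.toSubmodule := Submodule.map_subtype_le _ _
    rcases hSA.lt_or_eq with hlt | heq
    · left
      have hS : S = ⊥ := by
        by_contra hS
        exact hmin S ⟨le_trans hSA hAK, hS⟩ hlt
      have h' : s.toSubmodule.map A.toSubmodule.subtype = ⊥ :=
        congrArg Subrepresentation.toSubmodule hS
      exact Subrepresentation.toSubmodule_injective
        (Submodule.map_injective_of_injective A.toSubmodule.injective_subtype
          (h'.trans (Submodule.map_bot _).symm))
    · right
      refine Subrepresentation.toSubmodule_injective ?_
      apply Submodule.map_injective_of_injective A.toSubmodule.injective_subtype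
      exact heq.trans (A.toSubmodule.map_subtype_top).symm

/-- The operator by which a class function acts on a representation. -/
def Representation.classFunctionMap [Fintype G] {V : Type*} [AddCommGroup V] [Module ℂ V]
    (ρ : Representation ℂ G V) (f : G → ℂ) (hf : ∀ g h, f (h * g * h⁻¹) = f g) :
    IntertwiningMap ρ ρ where
  toLinearMap := ∑ g, f g • ρ g
  isIntertwining' x := by
    ext v
    simp only [LinearMap.comp_apply, LinearMap.sum_apply, LinearMap.smul_apply, map_sum, map_smul]
    refine Fintype.sum_equiv (MulAut.conj x⁻¹).toEquiv _ _ fun g => ?_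
    have h1 := hf g x⁻¹
    rw [inv_inv] at h1
    simp [← h1, ← Module.End.mul_apply, ← map_mul, mul_assoc]

/-- A class function whose sums against all irreducible characters vanish acts as zero. -/
theorem classFunctionMap_eq_zero [Fintype G] {V : Type*} [AddCommGroup V] [Module ℂ V]
    [FiniteDimensional ℂ V] (ρ : Representation ℂ G V) (f : G → ℂ)
    (hf : ∀ g h, f (h * g * h⁻¹) = f g)
    (h : ∀ ψ ∈ irrCharacters G, ∑ g, f g * ψ g = 0) : ∑ g, f g • ρ g = 0 := by
  let T := ρ.classFunctionMap f hf
  have hss : IsSemisimpleRepresentation ρ := inferInstance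
  -- By Maschke the kernel of `T` has an invariant complement. On an irreducible piece of it `T` is
  -- a scalar, whose trace is one of the vanishing sums, so the piece would lie in the kernel.
  obtain ⟨K, hK⟩ := exists_isCompl T.ker
  by_cases hbot : K = ⊥
  · have htop : T.ker = ⊤ := by simpa [hbot] using hK.sup_eq_top
    ext v
    have : v ∈ T.ker := htop ▸ Submodule.mem_top
    exact (IntertwiningMap.mem_ker _ _ T v).1 this
  exfalso
  obtain ⟨A, hAK, hA⟩ := exists_irreducible_le K hbot
  let S := A.toRepresentation.classFunctionMap f hf
  obtain ⟨c, hc⟩ := (IsIrreducible.algebraMap_intertwiningMap_bijective_of_isAlgClosed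
    (ρ := A.toRepresentation)).2 S
  have hS : ∑ g, f g • A.toRepresentation g = c • 1 := by
    have := congrArg (fun f => f.toLinearMap) hc
    rw [IntertwiningMap.algebraMap_apply] at this
    exact this.symm
  have hnt : Nontrivial A.toSubmodule := by
    obtain ⟨B, C, hBC⟩ := hA.toNontrivial
    by_contra hn
    rw [not_nontrivial_iff_subsingleton] at hn
    exact hBC (Subrepresentation.toSubmodule_injective (Subsingleton.elim _ _))
  have hc0 : c = 0 := by
    have htr := congrArg (LinearMap.trace ℂ A.toSubmodule) hS
    rw [map_sum] at htr
    simp only [map_smul, smul_eq_mul, LinearMap.trace_one] at htr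
    have h0 := h _ (character_mem_irrCharacters A.toRepresentation)
    simp only [character] at h0
    rw [h0] at htr
    have : (Module.finrank ℂ A.toSubmodule : ℂ) ≠ 0 :=
      Nat.cast_ne_zero.2 Module.finrank_pos.ne'
    exact (mul_eq_zero.1 htr.symm).resolve_right this
  obtain ⟨v, hv⟩ := exists_ne (0 : A.toSubmodule)
  have hvT : (v : V) ∈ T.ker := by
    rw [IntertwiningMap.mem_ker]
    have h1 := congrArg (fun F : Module.End ℂ A.toSubmodule => ((F v : A.toSubmodule) : V)) hS
    simp only [hc0, zero_smul, LinearMap.zero_apply, LinearMap.sum_apply] at h1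
    change (∑ g, f g • ρ g) (v : V) = 0
    rw [LinearMap.sum_apply]
    rw [Submodule.coe_sum] at h1
    exact h1
  have hbot' : (v : V) ∈ (⊥ : Subrepresentation ρ) := by
    rw [← hK.inf_eq_bot]
    exact ⟨hvT, hAK v.2⟩
  exact hv (Subtype.ext ((Submodule.mem_bot ℂ).1 hbot'))

/-- The irreducible characters are complete: a class function whose sums against all of them
vanish is zero. -/
theorem classFunction_eq_zero [Fintype G] (f : G → ℂ) (hf : ∀ g h, f (h * g * h⁻¹) = f g)
    (h : ∀ ψ ∈ irrCharacters G, ∑ g, f g * ψ g = 0) : f = 0 := by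
  classical
  let ρ : Representation ℂ G (G → ℂ) :=
    { toFun := fun g => LinearMap.funLeft ℂ ℂ (g⁻¹ * ·)
      map_one' := by ext; simp
      map_mul' := fun x y => by ext; simp [mul_assoc] }
  have h0 := classFunctionMap_eq_zero ρ f hf h
  ext x
  -- In the left regular representation `∑ g, f g • ρ g` sends the delta function at `1` to `f`.
  have := congrFun (LinearMap.congr_fun h0 (Pi.single 1 1)) x
  simpa [ρ, LinearMap.sum_apply, Finset.sum_apply, LinearMap.funLeft_apply, Pi.single_apply,
    inv_mul_eq_one] using this

end IrreducibleCharacters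

/-! ### Two columns differing in one entry -/

section Columns

variable {G : Type*} [Group G] {χ ψ : G → ℂ} {b b' : G}

theorem isConj_conj_iff (b g h : G) : IsConj b (h * g * h⁻¹) ↔ IsConj b g :=
  ⟨fun H => H.trans (isConj_iff.2 ⟨h, rfl⟩).symm, fun H => H.trans (isConj_iff.2 ⟨h, rfl⟩)⟩

open scoped Classical in
theorem sum_ite_isConj_mul [Fintype G] (hψ : ψ ∈ irrCharacters G) (b : G) :
    ∑ g, (if IsConj b g then 1 else 0) * ψ g = Nat.card {g // IsConj b g} * ψ b := by
  simp only [ite_mul, one_mul, zero_mul]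
  rw [← Finset.sum_filter, Finset.sum_congr rfl (g := fun _ => ψ b), Finset.sum_const,
    nsmul_eq_mul, Nat.card_eq_fintype_card, Fintype.card_subtype]
  intro g hg
  exact (irrCharacters_of_isConj hψ (Finset.mem_filter.1 hg).2).symm

theorem card_isConj_ne_zero [Finite G] (b : G) : (Nat.card {g // IsConj b g} : ℂ) ≠ 0 := by
  have : Nonempty {g // IsConj b g} := ⟨⟨b, IsConj.refl b⟩⟩
  exact Nat.cast_ne_zero.2 Nat.card_pos.ne'

open scoped Classical in
/-- The exceptional character of two columns which differ in one entry only is a multiple of the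
difference of the normalized indicator functions of the two classes. -/
theorem ColumnsDifferOnlyAt.mul_star_eq [Fintype G] (h : ColumnsDifferOnlyAt χ 1 b) (g : G) :
    Nat.card {g // IsConj b g} * ((χ 1 - χ b) * star (χ g)) =
      Nat.card G * ((Nat.card {g // IsConj b g} : ℂ) * (if g = 1 then 1 else 0) -
        if IsConj b g then 1 else 0) := by
  obtain ⟨hχ, -, hother⟩ := h
  set k : ℂ := (Nat.card {g // IsConj b g} : ℂ) with hk
  let f : G → ℂ := fun g => k * ((χ 1 - χ b) * star (χ g)) -
    Nat.card G * (k * (if g = 1 then 1 else 0) - if IsConj b g then 1 else 0)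
  suffices f = 0 from sub_eq_zero.1 (congrFun this g)
  refine classFunction_eq_zero f (fun g h => ?_) fun ψ hψ => ?_
  · simp only [f, irrCharacters_conj hχ, isConj_conj_iff, conj_eq_one_iff]
  have hsum : ∑ g, f g * ψ g = k * (χ 1 - χ b) * ∑ g, ψ g * star (χ g) -
      Nat.card G * (k * ψ 1 - k * ψ b) := by
    rw [← sum_ite_isConj_mul hψ b]
    have : ψ 1 = ∑ g, (if g = 1 then 1 else 0) * ψ g := by simp
    rw [this]
    simp only [Finset.mul_sum, ← Finset.sum_sub_distrib, f]
    exact Finset.sum_congr rfl fun g _ => by ring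
  rw [hsum]
  by_cases hψχ : ψ = χ
  · subst hψχ
    rw [irrCharacters_sum_mul_star_self hψ]
    ring
  · rw [irrCharacters_sum_mul_star hψ hχ hψχ, hother ψ hψ hψχ]
    ring

theorem ColumnsDifferOnlyAt.ne_one (h : ColumnsDifferOnlyAt χ 1 b) : b ≠ 1 := by
  rintro rfl
  exact h.2.1 rfl

theorem ColumnsDifferOnlyAt.card_eq [Finite G] (h : ColumnsDifferOnlyAt χ 1 b) :
    χ 1 * (χ 1 - χ b) = Nat.card G := by
  have := Fintype.ofFinite G
  have h1 := h.mul_star_eq 1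
  rw [if_pos rfl, if_neg (fun hc => h.ne_one (isConj_one_left.1 hc)), ← irrCharacters_inv h.1,
    inv_one] at h1
  refine mul_left_cancel₀ (card_isConj_ne_zero b) ?_
  linear_combination h1

theorem ColumnsDifferOnlyAt.card_class_mul [Finite G] (h : ColumnsDifferOnlyAt χ 1 b) :
    Nat.card {g // IsConj b g} * χ b = -χ 1 := by
  have := Fintype.ofFinite G
  have h1 := h.mul_star_eq b
  rw [if_neg h.ne_one, if_pos (IsConj.refl b), ← h.card_eq] at h1
  have h2 : Nat.card {g // IsConj b g} * star (χ b) = -χ 1 := by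
    refine mul_left_cancel₀ (sub_ne_zero.2 h.2.1) ?_
    linear_combination h1
  obtain ⟨n, -, hn⟩ := irrCharacters_exists_degree h.1
  rw [hn] at h2 ⊢
  have h3 := congrArg star h2
  simpa using h3

theorem ColumnsDifferOnlyAt.eq_zero [Finite G] (h : ColumnsDifferOnlyAt χ 1 b) {g : G}
    (hg : g ≠ 1) (hbg : ¬ IsConj b g) : χ g = 0 := by
  have := Fintype.ofFinite G
  have h1 := h.mul_star_eq g
  rw [if_neg hg, if_neg hbg] at h1
  have h2 := mul_ne_zero (card_isConj_ne_zero b) (sub_ne_zero.2 h.2.1)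
  rw [← mul_assoc, mul_zero, sub_zero, mul_zero] at h1
  exact star_eq_zero.1 ((mul_eq_zero.1 h1).resolve_left h2)

theorem irrCharacters_one_ne_zero (hχ : χ ∈ irrCharacters G) : χ 1 ≠ 0 := by
  obtain ⟨n, hn, h⟩ := irrCharacters_exists_degree hχ
  rw [h]
  exact Nat.cast_ne_zero.2 hn.ne'

theorem ColumnsDifferOnlyAt.apply_ne_zero [Finite G] (h : ColumnsDifferOnlyAt χ 1 b) :
    χ b ≠ 0 := fun h0 => irrCharacters_one_ne_zero h.1 <| by
  simpa [h0] using h.card_class_mul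

/-- Otherwise `χ b' = χ 1 ≠ 0`, which puts `b'` in the class of `b` and yields `χ b = χ 1`. -/
theorem ColumnsDifferOnlyAt.eq_of_columnsDifferOnlyAt [Finite G] (h : ColumnsDifferOnlyAt χ 1 b)
    (h' : ColumnsDifferOnlyAt ψ 1 b') : χ = ψ := by
  by_contra hne
  have h1 := h'.2.2 χ h.1 hne
  have hc : IsConj b b' := by
    by_contra hc
    exact irrCharacters_one_ne_zero h.1 (h1.trans (h.eq_zero h'.ne_one hc))
  exact h.2.1 (h1.trans (irrCharacters_of_isConj h.1 hc).symm)

theorem ColumnsDifferOnlyAt.apply_eq [Finite G] (h : ColumnsDifferOnlyAt χ 1 b)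
    (h' : ColumnsDifferOnlyAt χ 1 b') : χ b = χ b' :=
  sub_right_injective (mul_left_cancel₀ (irrCharacters_one_ne_zero h.1)
    (h.card_eq.trans h'.card_eq.symm))

theorem ColumnsDifferOnlyAt.isConj [Finite G] (h : ColumnsDifferOnlyAt χ 1 b)
    (h' : ColumnsDifferOnlyAt χ 1 b') : IsConj b b' := by
  by_contra hc
  exact h'.apply_ne_zero (h.eq_zero h'.ne_one hc)

/-- A nontrivial element is distinguished from the identity by some irreducible character. -/
theorem exists_irrCharacters_one_ne [Finite G] (hb : b ≠ 1) :
    ∃ ψ ∈ irrCharacters G, ψ 1 ≠ ψ b := by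
  classical
  have := Fintype.ofFinite G
  by_contra! hall
  set k : ℂ := (Nat.card {g // IsConj b g} : ℂ) with hk
  -- If no character separated `1` from `b`, this nonzero class function would pair to zero with all
  -- of them.
  have h0 := classFunction_eq_zero
    (fun g => k * (if g = 1 then 1 else 0) - if IsConj b g then 1 else 0) (fun g h => by
      simp only [isConj_conj_iff, conj_eq_one_iff]) fun ψ hψ => by
        simp only [sub_mul, Finset.sum_sub_distrib, sum_ite_isConj_mul hψ b, ← hk, ← hall ψ hψ]
        simp
  have := congrFun h0 b
  simp only [if_neg hb, if_pos (IsConj.refl b), mul_zero, zero_sub, Pi.zero_apply] at this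
  exact one_ne_zero (neg_eq_zero.1 this)

end Columns

/-! ### The case `χ b = -χ 1`: 2-groups of central type -/

section CentralType

variable {G : Type*} [Group G] [Finite G] {χ : G → ℂ} {b : G}

theorem ColumnsDifferOnlyAt.mem_center (h : ColumnsDifferOnlyAt χ 1 b) (hb : χ b = -χ 1) :
    b ∈ Subgroup.center G := by
  have h1 := h.card_class_mul
  rw [hb] at h1
  have hk : Nat.card {g // IsConj b g} = 1 := by
    have := mul_right_cancel₀ (neg_ne_zero.2 (irrCharacters_one_ne_zero h.1))
      (h1.trans (one_mul _).symm)
    exact_mod_cast this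
  obtain ⟨hs, -⟩ := Nat.card_eq_one_iff_unique.1 hk
  rw [Subgroup.mem_center_iff]
  intro g
  have := congrArg Subtype.val (hs.elim ⟨g * b * g⁻¹, isConj_iff.2 ⟨g, rfl⟩⟩ ⟨b, IsConj.refl b⟩)
  exact mul_inv_eq_iff_eq_mul.1 this

theorem ColumnsDifferOnlyAt.isTwoGroupOfCentralType (h : ColumnsDifferOnlyAt χ 1 b)
    (hG : 2 < Nat.card G) (hb : χ b = -χ 1) : IsTwoGroupOfCentralType G := by
  have := Fintype.ofFinite G
  have hbc := h.mem_center hb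
  have ha := irrCharacters_one_ne_zero h.1
  have hconj : ∀ g, IsConj b g → g = b := by
    intro g hg
    obtain ⟨c, rfl⟩ := isConj_iff.1 hg
    rw [Subgroup.mem_center_iff.1 hbc c, mul_inv_cancel_right]
  have hsupp : ∀ g, χ g ≠ 0 → g = 1 ∨ g = b := by
    intro g hg
    by_contra! hn
    exact hg (h.eq_zero hn.1 fun hc => hn.2 (hconj g hc))
  have hbb : b * b = 1 := by
    have h1 : χ b⁻¹ ≠ 0 := by
      rw [irrCharacters_inv h.1]
      exact star_ne_zero.2 h.apply_ne_zero
    rcases hsupp _ h1 with h2 | h2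
    · exact absurd (inv_eq_one.1 h2) h.ne_one
    · nth_rw 1 [← h2]
      exact inv_mul_cancel b
  have hcenter : ∀ z, z ∈ Subgroup.center G ↔ z = 1 ∨ z = b := by
    intro z
    refine ⟨fun hz => hsupp z ?_, ?_⟩
    -- A central element acts by a scalar of finite order, hence nonzero, so `χ` does not vanish
    -- there.
    · obtain ⟨c, hc, hcpow⟩ := irrCharacters_center h.1 hz
      have h1 := hcpow (Nat.card G)
      rw [pow_card_eq_one'] at h1
      rw [hc]
      refine mul_ne_zero ?_ ha
      rintro rfl
      rw [zero_pow Nat.card_pos.ne', zero_mul] at h1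
      exact ha h1
    · rintro (rfl | rfl)
      · exact one_mem _
      · exact hbc
  have hZ : Nat.card (Subgroup.center G) = 2 := by
    have : ((Subgroup.center G : Subgroup G) : Set G) = {1, b} := by
      ext z
      simpa using hcenter z
    change Nat.card ((Subgroup.center G : Subgroup G) : Set G) = 2
    rw [this, Nat.card_coe_set_eq, Set.ncard_pair h.ne_one.symm]
  obtain ⟨n, hn, hχn⟩ := irrCharacters_exists_degree h.1
  have hcard : Nat.card G = 2 * (n * n) := by
    have h1 := h.card_eq
    rw [hb, hχn] at h1
    have h2 : (Nat.card G : ℂ) = ((2 * (n * n) : ℕ) : ℂ) := by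
      rw [← h1]; push_cast; ring
    exact_mod_cast h2
  have hindex : (Subgroup.center G).index = n * n := by
    have h1 := (Subgroup.center G).card_mul_index
    rw [hZ, hcard] at h1
    exact Nat.eq_of_mul_eq_mul_left two_pos h1
  refine ⟨hG, ?_, ⟨χ, h.1, ?_⟩, hZ⟩
  · refine IsPGroup.of_card (Nat.eq_prime_pow_of_unique_prime_dvd Nat.card_pos.ne' ?_)
    intro p hp hpG
    by_contra hp2
    have := Fact.mk hp
    obtain ⟨P⟩ : Nonempty (Sylow p G) := inferInstance
    have hbP : b ∉ P := by
      intro hbP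
      obtain ⟨k, hk⟩ := IsPGroup.iff_orderOf.1 P.isPGroup' ⟨b, hbP⟩
      have h2 : orderOf (⟨b, hbP⟩ : P) = 2 := by
        refine orderOf_eq_prime (Subtype.ext ?_) fun hb1 => h.ne_one (congrArg Subtype.val hb1)
        simpa [sq] using hbb
      rw [h2] at hk
      exact hp2 ((Nat.prime_dvd_prime_iff_eq hp Nat.prime_two).1
        (hk ▸ dvd_pow_self p (by rintro rfl; simp at hk)))
    have : Fintype (P : Subgroup G) := Fintype.ofFinite _
    -- As `b` has order 2 it avoids `P`, so only the identity contributes and `|P|` divides `n`.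
    -- Then `|P|²` divides `|G| = 2n²`, which is impossible for a nontrivial Sylow subgroup.
    obtain ⟨m, hm⟩ := irrCharacters_sum_subgroup h.1 (P : Subgroup G)
    rw [Fintype.sum_eq_single 1] at hm
    swap
    · intro x hx
      by_contra hx0
      rcases hsupp _ hx0 with h1 | h1
      · exact hx (Subtype.ext h1)
      · exact hbP (h1 ▸ x.2)
    have hnm : n = Nat.card P * m := by
      have : (n : ℂ) = ((Nat.card P * m : ℕ) : ℂ) := by
        rw [← hχn]; push_cast; exact hm
      exact_mod_cast this
    have hpP : p ∣ Nat.card P := P.dvd_card_of_dvd_card hpG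
    refine P.not_dvd_index' ?_ ?_
    · exact Subgroup.index_ne_zero_of_finite
    have h1 := (P : Subgroup G).card_mul_index
    have h2 : (P : Subgroup G).index = 2 * (Nat.card P * m * m) := by
      refine Nat.eq_of_mul_eq_mul_left (Nat.card_pos (α := P)) ?_
      change Nat.card P * _ = _ at h1
      rw [h1, hcard, hnm]
      ring
    rw [h2]
    exact ((hpP.mul_right m).mul_right m).mul_left 2
  · rw [hindex, hχn]
    push_cast
    ring

theorem IsTwoGroupOfCentralType.exists_columnsDifferOnlyAt (h : IsTwoGroupOfCentralType G) :
    ∃ (χ : G → ℂ) (b : G), ColumnsDifferOnlyAt χ 1 b ∧ χ b = -χ 1 := by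
  classical
  have := Fintype.ofFinite G
  obtain ⟨hG, -, ⟨χ, hχ, hidx⟩, hZ⟩ := h
  obtain ⟨⟨z, hz⟩, hz1⟩ : ∃ z : Subgroup.center G, z ≠ 1 := by
    have : Nontrivial (Subgroup.center G) := (Finite.one_lt_card_iff_nontrivial).1 (by omega)
    exact exists_ne 1
  have hz1' : z ≠ 1 := fun h => hz1 (Subtype.ext h)
  have ha := irrCharacters_one_ne_zero hχ
  obtain ⟨n, hn, hχn⟩ := irrCharacters_exists_degree hχ
  have hcard : Nat.card G = 2 * (n * n) := by
    rw [hχn] at hidx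
    have h1 : (Subgroup.center G).index = n ^ 2 := by exact_mod_cast hidx
    rw [← (Subgroup.center G).card_mul_index, hZ, h1, sq]
  have hzz : z ^ 2 = 1 := by
    have h1 := pow_card_eq_one' (x := (⟨z, hz⟩ : Subgroup.center G))
    rw [hZ] at h1
    exact congrArg Subtype.val h1
  obtain ⟨c, hc, hcpow⟩ := irrCharacters_center hχ hz
  have hc2 : c ^ 2 = 1 := by
    have h1 := hcpow 2
    rw [hzz] at h1
    exact mul_right_cancel₀ ha (h1.symm.trans (one_mul _).symm)
  have hstar : star (χ z) = χ z := by
    rw [← irrCharacters_inv hχ, inv_eq_of_mul_eq_one_right (by rw [← sq]; exact hzz)]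
  have hχzz : χ z * χ z = n * n := by
    rw [hc, hχn]
    linear_combination (n * n : ℂ) * hc2
  have hsplit : ∀ f : G → ℂ, ∑ g, f g = f 1 + f z + ∑ g ∈ (Finset.univ.erase 1).erase z, f g := by
    intro f
    rw [add_assoc, Finset.add_sum_erase _ _ (Finset.mem_erase.2 ⟨hz1', Finset.mem_univ z⟩),
      Finset.add_sum_erase _ _ (Finset.mem_univ _)]
  -- The elements `1` and `z` already contribute `2n² = |G|` to the norm sum.
  have hvan : ∀ g, g ≠ 1 → g ≠ z → χ g = 0 := by
    have h1 := irrCharacters_sum_mul_star_self hχ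
    rw [hsplit, hstar, hχzz, hχn, hcard] at h1
    have h2 : ∑ g ∈ (Finset.univ.erase 1).erase z, Complex.normSq (χ g) = 0 := by
      have h3 : ∑ g ∈ (Finset.univ.erase 1).erase z, χ g * star (χ g) = 0 := by
        have : star (n : ℂ) = n := by simp
        rw [this] at h1
        push_cast at h1
        linear_combination h1
      simp only [Complex.star_def, Complex.mul_conj] at h3
      exact_mod_cast h3
    intro g hg1 hgz
    exact Complex.normSq_eq_zero.1 ((Finset.sum_eq_zero_iff_of_nonneg
      fun _ _ => Complex.normSq_nonneg _).1 h2 g (by simp [hg1, hgz]))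
  have horth : ∀ ψ ∈ irrCharacters G, ψ ≠ χ → ψ 1 * n + ψ z * χ z = 0 := by
    intro ψ hψ hne
    have h1 := irrCharacters_sum_mul_star hψ hχ hne
    rw [hsplit, hstar, hχn, Finset.sum_eq_zero] at h1
    · simpa using h1
    · intro g hg
      simp only [Finset.mem_erase] at hg
      rw [hvan g hg.2.1 hg.1, star_zero, mul_zero]
  have hn0 : (n : ℂ) ≠ 0 := Nat.cast_ne_zero.2 hn.ne'
  have hneg : χ z = -χ 1 := by
    rcases mul_self_eq_one_iff.1 ((sq c).symm.trans hc2) with h1 | h1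
    · exfalso
      by_cases htriv : (fun _ => 1 : G → ℂ) = χ
      · have : (n : ℂ) = 1 := by rw [← hχn, ← htriv]
        -- A trivial `χ` would give `|G| = 2`; this is where the order must exceed 2.
        have : n = 1 := by exact_mod_cast this
        rw [this] at hcard
        omega
      · have h2 := horth _ one_mem_irrCharacters htriv
        rw [hc, h1, hχn] at h2
        apply hn0
        linear_combination h2 / 2
    · rw [hc, h1, neg_one_mul]
  refine ⟨χ, z, ⟨hχ, ?_, ?_⟩, hneg⟩
  · rw [hneg]
    intro h1
    apply ha
    linear_combination h1 / 2
  · intro ψ hψ hne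
    have h1 := horth ψ hψ hne
    rw [hneg, hχn] at h1
    refine mul_right_cancel₀ hn0 ?_
    linear_combination h1

end CentralType

/-! ### The case `χ b = -1`: doubly transitive Frobenius groups -/

section Frobenius

variable {G : Type*} [Group G] {H : Subgroup G}

theorem one_mem_frobeniusKernel (H : Subgroup G) : (1 : G) ∈ frobeniusKernel H := Or.inl rfl

open scoped Classical in
/-- Summing a class function over the elements outside the Frobenius kernel. -/
theorem IsFrobeniusComplement.sum_compl_kernel [Fintype G] (hH : IsFrobeniusComplement H)
    (φ : G → ℂ) (hφ : ∀ g h, φ (h * g * h⁻¹) = φ g) :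
    (Nat.card H : ℂ) * ∑ g with g ∉ frobeniusKernel H, φ g =
      Nat.card G * (∑ h : H, φ h - φ 1) := by
  -- Double counting of the pairs `(x, g)` with `g ≠ 1` and `x * g * x⁻¹ ∈ H`: here with `x` fixed,
  -- in `hcol` with `g` fixed.
  have hrow : ∀ x : G, ∑ g, (if x * g * x⁻¹ ∈ H ∧ g ≠ 1 then φ g else 0) =
      ∑ h : H, φ h - φ 1 := by
    intro x
    have h1 : ∑ g, (if x * g * x⁻¹ ∈ H ∧ g ≠ 1 then φ g else 0) =
        ∑ g, if g ∈ H ∧ g ≠ 1 then φ g else 0 := by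
      refine Fintype.sum_equiv (MulAut.conj x).toEquiv _ _ fun g => ?_
      simp [hφ]
    have h2 : ∑ h : H, φ h = ∑ g, if g ∈ H then φ g else 0 := by
      rw [← Finset.sum_filter]
      exact (Finset.sum_subtype _ (by simp) φ).symm
    have h3 : φ 1 = ∑ g, if g = 1 then φ g else 0 := by simp
    rw [h1, h2, h3, ← Finset.sum_sub_distrib]
    refine Finset.sum_congr rfl fun g _ => ?_
    by_cases hg : g = 1
    · subst hg
      simp [one_mem]
    · simp [hg]
  have hcol : ∀ g : G, ∑ x : G, (if x * g * x⁻¹ ∈ H ∧ g ≠ 1 then φ g else 0) =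
      if g ∉ frobeniusKernel H then Nat.card H * φ g else 0 := by
    intro g
    by_cases hg : g ∈ frobeniusKernel H
    swap
    · rw [if_pos hg]
      simp only [frobeniusKernel, Set.mem_ofPred_eq, not_or, not_forall, not_not] at hg
      obtain ⟨hg1, x₀, hx₀⟩ := hg
      -- By the Frobenius condition the elements conjugating `g` into `H` form the single coset `H
      -- x₀`.
      have hiff : ∀ x, (x * g * x⁻¹ ∈ H ∧ g ≠ 1) ↔ x * x₀⁻¹ ∈ H := by
        intro x
        have hx : x * g * x⁻¹ = (x * x₀⁻¹) * (x₀ * g * x₀⁻¹) * (x * x₀⁻¹)⁻¹ := by group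
        rw [hx]
        refine ⟨fun h => ?_, fun h => ⟨H.mul_mem (H.mul_mem h hx₀) (H.inv_mem h), hg1⟩⟩
        by_contra hn
        exact hg1 (conj_eq_one_iff.1 (hH.2.2 _ hn _ hx₀ h.1))
      simp only [hiff]
      rw [Fintype.sum_equiv (_root_.Equiv.mulRight x₀⁻¹) _ (fun y => if y ∈ H then φ g else 0)
        (fun x => by rw [Equiv.coe_mulRight]), ← Finset.sum_filter, Finset.sum_const, nsmul_eq_mul,
        Nat.card_eq_fintype_card, Fintype.card_subtype]
    · rw [if_neg (not_not.2 hg)]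
      refine Finset.sum_eq_zero fun x _ => if_neg fun h => ?_
      rcases hg with h1 | h1
      · exact h.2 h1
      · exact h1 x h.1
  rw [Finset.mul_sum, Finset.sum_filter, ← Finset.sum_congr rfl fun g _ => hcol g,
    Finset.sum_comm, Finset.sum_congr rfl fun x _ => hrow x, Finset.sum_const, nsmul_eq_mul,
    Finset.card_univ, Nat.card_eq_fintype_card]

theorem IsFrobeniusComplement.card_mul_card_kernel [Finite G] (hH : IsFrobeniusComplement H) :
    Nat.card H * Nat.card (frobeniusKernel H) = Nat.card G := by
  classical
  have := Fintype.ofFinite G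
  have h1 := hH.sum_compl_kernel (fun _ => 1) (fun _ _ => rfl)
  have h2 : (Nat.card (frobeniusKernel H) : ℂ) + ∑ g with g ∉ frobeniusKernel H, (1 : ℂ) =
      Nat.card G := by
    rw [Nat.card_eq_fintype_card, Fintype.card_subtype, Finset.sum_const, nsmul_eq_mul, mul_one,
      ← Nat.cast_add, Nat.card_eq_fintype_card, Finset.card_filter_add_card_filter_not,
      Finset.card_univ]
  simp only [Finset.sum_const, nsmul_eq_mul, mul_one, Finset.card_univ,
    ← Nat.card_eq_fintype_card] at h1 h2
  have h3 : ((Nat.card H * Nat.card (frobeniusKernel H) : ℕ) : ℂ) = Nat.card G := by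
    push_cast
    linear_combination (Nat.card H : ℂ) * h2 - h1
  exact_mod_cast h3

/-- In a doubly transitive Frobenius group the nontrivial elements of the kernel form a single
conjugacy class. -/
theorem IsFrobeniusComplement.isConj_iff_mem_kernel [Finite G] (hH : IsFrobeniusComplement H)
    (hcard : Nat.card H + 1 = Nat.card (frobeniusKernel H)) {b : G} (hb : b ∈ frobeniusKernel H)
    (hb1 : b ≠ 1) (g : G) : IsConj b g ↔ g ∈ frobeniusKernel H ∧ g ≠ 1 := by
  have hbH : ∀ x : G, x * b * x⁻¹ ∉ H := hb.resolve_left hb1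
  have hmem : ∀ x : G, x * b * x⁻¹ ∈ frobeniusKernel H \ {1} := fun x =>
    ⟨Or.inr fun y => by simpa [mul_assoc] using hbH (y * x),
      fun h => hb1 (conj_eq_one_iff.1 h)⟩
  constructor
  · intro h
    obtain ⟨c, rfl⟩ := isConj_iff.1 h
    exact hmem c
  · intro hg
    -- No nontrivial element of `H` commutes with `b ∉ H`, so this orbit map is injective; equal
    -- cardinalities make it onto.
    let f : H → (frobeniusKernel H \ {1} : Set G) := fun h => ⟨h * b * (h : G)⁻¹, hmem h⟩
    have hf : Function.Injective f := by
      intro x y hxy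
      have hxy' : (x : G) * b * (x : G)⁻¹ = y * b * (y : G)⁻¹ := congrArg Subtype.val hxy
      have hcomm : b * ((y : G)⁻¹ * x) * b⁻¹ = (y : G)⁻¹ * x := by
        have : ((y : G)⁻¹ * x) * b = b * ((y : G)⁻¹ * x) := by
          calc _ = (y : G)⁻¹ * (x * b * (x : G)⁻¹) * x := by group
            _ = _ := by rw [hxy']; group
        rw [← this, mul_inv_cancel_right]
      have hyx : (y : G)⁻¹ * x ∈ H := H.mul_mem (H.inv_mem y.2) x.2
      have h1 := hH.2.2 b (by simpa using hbH 1) _ hyx (hcomm.symm ▸ hyx)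
      exact Subtype.ext (inv_mul_eq_one.1 h1).symm
    have hcard' : Nat.card H = Nat.card (frobeniusKernel H \ {1} : Set G) := by
      rw [Nat.card_coe_set_eq, Set.ncard_sdiff_singleton_of_mem (one_mem_frobeniusKernel H),
        ← Nat.card_coe_set_eq, ← hcard, Nat.add_sub_cancel]
    obtain ⟨h, hh⟩ := (hf.bijective_of_nat_card_le hcard'.ge).2 ⟨g, hg⟩
    exact isConj_iff.2 ⟨h, congrArg Subtype.val hh⟩

/-- Splitting a sum over the group when the nontrivial kernel elements contribute equally. -/
theorem sum_eq_kernel_add_compl [Fintype G] [DecidablePred (· ∈ frobeniusKernel H)] (f : G → ℂ)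
    {b : G} (hcard : Nat.card H + 1 = Nat.card (frobeniusKernel H))
    (hf : ∀ g ∈ frobeniusKernel H, g ≠ 1 → f g = f b) :
    ∑ g, f g = f 1 + Nat.card H * f b + ∑ g with g ∉ frobeniusKernel H, f g := by
  classical
  rw [← Finset.sum_filter_add_sum_filter_not Finset.univ (· ∈ frobeniusKernel H) f]
  congr 1
  rw [← Finset.add_sum_erase _ _ (show (1 : G) ∈ _ by simp [one_mem_frobeniusKernel]),
    Finset.sum_congr rfl (g := fun _ => f b), Finset.sum_const, nsmul_eq_mul,
    Finset.card_erase_of_mem (by simp [one_mem_frobeniusKernel])]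
  · rw [← Fintype.card_subtype, ← Nat.card_eq_fintype_card]
    congr 3
    change Nat.card (frobeniusKernel H) - 1 = _
    omega
  · intro g hg
    simp only [Finset.mem_erase, Finset.mem_filter] at hg
    exact hf g hg.2.2 hg.1

/-- In a doubly transitive Frobenius group an irreducible character which is not constant on the
kernel is the permutation character on the cosets of the complement, minus one. -/
theorem IsFrobeniusComplement.character_values [Finite G] (hH : IsFrobeniusComplement H)
    (hcard : Nat.card H + 1 = Nat.card (frobeniusKernel H)) {b : G} (hb : b ∈ frobeniusKernel H)
    (hb1 : b ≠ 1) {ψ : G → ℂ} (hψ : ψ ∈ irrCharacters G) (hne : ψ 1 ≠ ψ b) :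
    ψ 1 = Nat.card H ∧ ψ b = -1 ∧ ∀ g ∉ frobeniusKernel H, ψ g = 0 := by
  classical
  have := Fintype.ofFinite G
  have hconst : ∀ g ∈ frobeniusKernel H, g ≠ 1 → ψ g = ψ b := fun g hg hg1 =>
    (irrCharacters_of_isConj hψ ((hH.isConj_iff_mem_kernel hcard hb hb1 g).2 ⟨hg, hg1⟩)).symm
  obtain ⟨d, -, hψd⟩ := irrCharacters_exists_degree hψ
  obtain ⟨m, hm⟩ := irrCharacters_sum_subgroup hψ H
  set a := Nat.card H with ha
  have ha0 : 0 < a := Nat.card_pos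
  have hG : Nat.card G = a * (a + 1) := by rw [hcard, ha, hH.card_mul_card_kernel]
  have htriv : ψ ≠ fun _ => 1 := by
    rintro rfl
    exact hne rfl
  have ha0' : (a : ℂ) ≠ 0 := Nat.cast_ne_zero.2 ha0.ne'
  -- Orthogonality to the trivial character, with the sum off the kernel evaluated through the
  -- `m`-dimensional space of `H`-fixed vectors.
  have hψb : ψ b = d - (a + 1) * m := by
    have h1 := irrCharacters_sum_mul_star hψ one_mem_irrCharacters htriv
    simp only [star_one, mul_one] at h1
    rw [sum_eq_kernel_add_compl ψ hcard hconst, hψd] at h1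
    have h2 := hH.sum_compl_kernel ψ (irrCharacters_conj hψ)
    rw [← ha, hm, hψd, hG] at h2
    push_cast at h2
    have h3 : ∑ g with g ∉ frobeniusKernel H, ψ g = (a + 1) * (a * m - d) := by
      refine mul_left_cancel₀ ha0' ?_
      rw [h2]
      ring
    rw [← ha, h3] at h1
    refine mul_left_cancel₀ ha0' ?_
    linear_combination h1
  have hm0 : 1 ≤ m := by
    rw [Nat.one_le_iff_ne_zero]
    rintro rfl
    apply hne
    rw [hψb, hψd]
    simp
  have hnorm := irrCharacters_sum_mul_star_self hψ
  rw [sum_eq_kernel_add_compl (fun g => ψ g * star (ψ g)) (b := b) hcard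
    (fun g hg hg1 => by simp only [hconst g hg hg1])] at hnorm
  set R := ∑ g with g ∉ frobeniusKernel H, Complex.normSq (ψ g) with hR
  have hRcast : ∑ g with g ∉ frobeniusKernel H, ψ g * star (ψ g) = (R : ℂ) := by
    rw [hR, Complex.ofReal_sum]
    exact Finset.sum_congr rfl fun g _ => Complex.mul_conj _
  have hR0 : 0 ≤ R := Finset.sum_nonneg fun _ _ => Complex.normSq_nonneg _
  have hreal : (d : ℝ) * d + a * ((d - (a + 1) * m) * (d - (a + 1) * m)) + R = a * (a + 1) := by
    rw [hRcast, hψb, hψd, hG] at hnorm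
    have hs1 : star (d : ℂ) = d := by simp
    have hs2 : star ((d : ℂ) - (a + 1) * m) = d - (a + 1) * m := by simp
    rw [hs1, hs2, ← ha] at hnorm
    exact_mod_cast hnorm
  have ha1 : (0 : ℝ) < a := by exact_mod_cast ha0
  have hm1 : (1 : ℝ) ≤ m := by exact_mod_cast hm0
  -- The norm relation rearranged; since `m ≥ 1`, every summand is nonnegative, which forces `m =
  -- 1`, `d = a` and `R = 0`.
  have hkey : ((a : ℝ) + 1) * ((d - a * m) ^ 2 + a * (m ^ 2 - 1)) + R = 0 := by
    linear_combination hreal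
  have hsq : 0 ≤ (a : ℝ) * (m ^ 2 - 1) := by
    apply mul_nonneg ha1.le
    nlinarith
  have hprod : 0 ≤ ((a : ℝ) + 1) * ((d - a * m) ^ 2 + a * (m ^ 2 - 1)) := by positivity
  have hRz : R = 0 := by linarith
  have hbr : ((d : ℝ) - a * m) ^ 2 + a * (m ^ 2 - 1) = 0 := by
    have : ((a : ℝ) + 1) * ((d - a * m) ^ 2 + a * (m ^ 2 - 1)) = 0 := by linarith
    exact (mul_eq_zero.1 this).resolve_left (by positivity)
  have hmeq : (m : ℝ) = 1 := by
    have h1 : (a : ℝ) * (m ^ 2 - 1) = 0 := by nlinarith [sq_nonneg ((d : ℝ) - a * m)]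
    have h2 := (mul_eq_zero.1 h1).resolve_left ha1.ne'
    nlinarith
  have hdeq : (d : ℝ) = a := by
    rw [hmeq] at hbr
    have : ((d : ℝ) - a * 1) ^ 2 = 0 := by linarith
    have := pow_eq_zero_iff two_ne_zero |>.1 this
    linarith
  have hmn : m = 1 := by exact_mod_cast hmeq
  have hdn : d = a := by exact_mod_cast hdeq
  refine ⟨by rw [hψd, hdn], by rw [hψb, hdn, hmn]; push_cast; ring, fun g hg => ?_⟩
  exact Complex.normSq_eq_zero.1 ((Finset.sum_eq_zero_iff_of_nonneg
    fun _ _ => Complex.normSq_nonneg _).1 (hR.symm.trans hRz) g (by simp [hg]))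

/-- Some irreducible character separates `1` from a nontrivial kernel element, and
`character_values` fixes all its values, so there is only one. -/
theorem IsDoublyTransitiveFrobenius.exists_columnsDifferOnlyAt [Finite G]
    (h : IsDoublyTransitiveFrobenius G) :
    2 < Nat.card G ∧ ∃ (χ : G → ℂ) (b : G), ColumnsDifferOnlyAt χ 1 b ∧ χ b = -1 := by
  obtain ⟨H, hH, hcard⟩ := h
  have hH2 : 1 < Nat.card H := (Subgroup.one_lt_card_iff_ne_bot H).2 hH.1
  refine ⟨?_, ?_⟩
  · rw [← hH.card_mul_card_kernel, ← hcard]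
    nlinarith
  obtain ⟨b, hb, hb1⟩ : ∃ b ∈ frobeniusKernel H, b ≠ 1 := by
    refine Set.exists_ne_of_one_lt_ncard ?_ 1
    rw [← Nat.card_coe_set_eq]
    omega
  obtain ⟨χ, hχ, hne⟩ := exists_irrCharacters_one_ne hb1
  obtain ⟨h1, h2, h3⟩ := hH.character_values hcard hb hb1 hχ hne
  refine ⟨χ, b, ⟨hχ, hne, fun ψ hψ hψχ => ?_⟩, h2⟩
  by_contra hne'
  obtain ⟨h1', h2', h3'⟩ := hH.character_values hcard hb hb1 hψ hne'
  apply hψχ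
  ext g
  by_cases hg : g ∈ frobeniusKernel H
  · by_cases hg1 : g = 1
    · rw [hg1, h1, h1']
    · have hc := (hH.isConj_iff_mem_kernel hcard hb hb1 g).2 ⟨hg, hg1⟩
      rw [← irrCharacters_of_isConj hχ hc, ← irrCharacters_of_isConj hψ hc, h2, h2']
  · rw [h3 g hg, h3' g hg]

/-- The common kernel of all irreducible characters but one. -/
def kernelOfOthers [Finite G] (χ : G → ℂ) : Subgroup G where
  carrier := {g | ∀ ψ ∈ irrCharacters G, ψ ≠ χ → ψ g = ψ 1}
  one_mem' _ _ _ := rfl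
  mul_mem' hx hy ψ hψ hne := irrCharacters_mul_eq_degree hψ (hx ψ hψ hne) (hy ψ hψ hne)
  inv_mem' := fun {x} hx ψ hψ hne => by
    rw [irrCharacters_inv hψ, hx ψ hψ hne, ← irrCharacters_inv hψ, inv_one]

/-- A further element `g` would have `χ g = 0 ≠ χ 1`, making it another exceptional column, and that
class is unique. -/
theorem ColumnsDifferOnlyAt.mem_kernelOfOthers [Finite G] {χ : G → ℂ} {b : G}
    (h : ColumnsDifferOnlyAt χ 1 b) (g : G) : g ∈ kernelOfOthers χ ↔ g = 1 ∨ IsConj b g := by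
  constructor
  · intro hg
    by_contra! hn
    have h0 := h.eq_zero hn.1 hn.2
    have hg' : ColumnsDifferOnlyAt χ 1 g := ⟨h.1, fun h1 => irrCharacters_one_ne_zero h.1
      (h1.trans h0), fun ψ hψ hne => (hg ψ hψ hne).symm⟩
    exact hn.2 (h.isConj hg')
  · rintro (rfl | hg) ψ hψ hne
    · rfl
    · rw [← irrCharacters_of_isConj hψ hg, h.2.2 ψ hψ hne]

theorem ColumnsDifferOnlyAt.isDoublyTransitiveFrobenius [Finite G] {χ : G → ℂ} {b : G}
    (h : ColumnsDifferOnlyAt χ 1 b) (hG : 2 < Nat.card G) (hb : χ b = -1) :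
    IsDoublyTransitiveFrobenius G := by
  classical
  obtain ⟨a, ha0, hχa⟩ := irrCharacters_exists_degree h.1
  have hcard : Nat.card G = a * (a + 1) := by
    have h1 := h.card_eq
    rw [hb, hχa] at h1
    have : ((a * (a + 1) : ℕ) : ℂ) = Nat.card G := by
      rw [← h1]; push_cast; ring
    exact_mod_cast this.symm
  have hclass : Nat.card {g // IsConj b g} = a := by
    have h1 := h.card_class_mul
    rw [hb, hχa, mul_neg_one, neg_inj] at h1
    exact_mod_cast h1
  let N := kernelOfOthers χ
  have hN := h.mem_kernelOfOthers
  have hNcard : Nat.card N = a + 1 := by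
    have h1 : (N : Set G) = insert 1 {g | IsConj b g} := by
      ext g
      exact hN g
    change Nat.card (N : Set G) = _
    rw [h1, Nat.card_coe_set_eq, Set.ncard_insert_of_notMem, ← Nat.card_coe_set_eq]
    · rw [← hclass]
      rfl
    · exact fun hc => h.ne_one (isConj_one_left.1 hc)
  have hnormal : N.Normal := ⟨fun n hn g => (hN _).2 <| ((hN n).1 hn).imp
    (fun h => by simp [h]) (fun h => (isConj_conj_iff b n g).2 h)⟩
  have hidx : N.index = a := by
    have h1 := N.card_mul_index
    rw [hNcard, hcard, mul_comm a] at h1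
    exact Nat.eq_of_mul_eq_mul_left a.succ_pos h1
  have hcop : Nat.Coprime (a + 1) a := by simp
  obtain ⟨H, hH⟩ := Subgroup.exists_right_complement'_of_coprime (N := N)
    (by rw [hNcard, hidx]; exact hcop)
  have hHcard : Nat.card H = a := hH.symm.index_eq_card.symm.trans hidx
  have hdisj : ∀ x, x ∈ N → x ∈ H → x = 1 := fun x hx hx' =>
    Subgroup.disjoint_def.1 hH.disjoint hx hx'
  have ha2 : 1 < a := by
    by_contra hle
    have : a = 1 := by omega
    rw [hcard, this] at hG
    omega
  -- The class of `n` has `a` elements, so its centralizer has order `a + 1`, coprime to `|H| = a`.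
  have hcent : ∀ n ∈ N, n ≠ 1 → ∀ y ∈ H, y * n = n * y → y = 1 := by
    intro n hn hn1 y hy hcomm
    have hbn : IsConj b n := ((hN n).1 hn).resolve_left hn1
    have h1 : Nat.card (MulAction.stabilizer (ConjAct G) n) = a + 1 := by
      have hcl : Nat.card (MulAction.orbit (ConjAct G) n) = a := by
        rw [← hclass]
        refine Nat.card_congr (Equiv.subtypeEquivRight fun g => ?_)
        rw [ConjAct.mem_orbit_conjAct]
        exact ⟨fun hg => hbn.trans hg.symm, fun hg => hg.symm.trans hbn⟩
      have h2 := Nat.card_congr (MulAction.orbitProdStabilizerEquivGroup (ConjAct G) n)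
      rw [Nat.card_prod, hcl, show Nat.card (ConjAct G) = Nat.card G from rfl, hcard] at h2
      exact Nat.eq_of_mul_eq_mul_left ha0 h2
    have h2 : orderOf y ∣ a + 1 := by
      rw [← h1, ← ConjAct.toConjAct.orderOf_eq y]
      refine Subgroup.orderOf_dvd_natCard _ ?_
      rw [MulAction.mem_stabilizer_iff, ConjAct.toConjAct_smul, hcomm, mul_inv_cancel_right]
    have h3 : orderOf y ∣ a := by
      rw [← hHcard]
      exact Subgroup.orderOf_dvd_natCard _ hy
    exact orderOf_eq_one_iff.1 (Nat.eq_one_of_dvd_coprimes hcop h2 h3)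
  have hFrob : IsFrobeniusComplement H := by
    refine ⟨?_, ?_, ?_⟩
    · rw [← Subgroup.one_lt_card_iff_ne_bot, hHcard]
      exact ha2
    · rintro rfl
      rw [Subgroup.card_top, hcard] at hHcard
      nlinarith
    · intro g hg x hx hgx
      have hgNH : g ∈ N ⊔ H := hH.sup_eq_top ▸ Subgroup.mem_top g
      obtain ⟨n, hn, k, hk, rfl⟩ := Subgroup.mem_sup_of_normal_left.1 hgNH
      have hn1 : n ≠ 1 := by
        rintro rfl
        exact hg (by simpa using hk)
      set y := k * x * k⁻¹ with hy
      have hyH : y ∈ H := H.mul_mem (H.mul_mem hk hx) (H.inv_mem hk)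
      -- With `g = n * k`, this commutator lies in `N ∩ H = 1`, so `y` commutes with `n ≠ 1`.
      have h1 : n * y * n⁻¹ * y⁻¹ ∈ H := by
        refine H.mul_mem ?_ (H.inv_mem hyH)
        convert hgx using 1
        rw [hy]; group
      have h2 : n * y * n⁻¹ * y⁻¹ ∈ N := by
        have := N.mul_mem hn (hnormal.conj_mem _ (N.inv_mem hn) y)
        convert this using 1
        group
      have h3 := hdisj _ h2 h1
      have h4 : y * n = n * y := by
        rw [mul_inv_eq_one, mul_inv_eq_iff_eq_mul] at h3
        exact h3.symm
      exact conj_eq_one_iff.1 (hcent n hn hn1 y hyH h4)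
  refine ⟨H, hFrob, ?_⟩
  -- Counting alone gives the kernel `a + 1` elements; it need not be identified with `N`.
  have h1 := hFrob.card_mul_card_kernel
  rw [hHcard, hcard] at h1
  rw [hHcard, Nat.eq_of_mul_eq_mul_left ha0 h1]

end Frobenius

/-! ### Assembly of the theorem -/

/-- A finite group is an extreme `CD1`-group iff it is a `2`-group of central type (of order
greater than `2`) with centre of order `2`, or a doubly transitive Frobenius group; and in a
`CD1`-group the former case is exactly the case `b_k = -a_k`, the latter exactly `b_k = -1`,
where `a_k = χ 1` and `b_k = χ b`. -/
theorem theorem1 (G : Type*) [Group G] [Finite G] :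
    (IsExtremeCD1Group G ↔ IsTwoGroupOfCentralType G ∨ IsDoublyTransitiveFrobenius G) ∧
    (IsCD1Group G → ∀ (χ : G → ℂ) (b : G), ColumnsDifferOnlyAt χ 1 b →
      (χ b = -χ 1 ↔ IsTwoGroupOfCentralType G) ∧
      (χ b = -1 ↔ IsDoublyTransitiveFrobenius G)) := by
  refine ⟨⟨?_, ?_⟩, fun hG χ b h => ⟨⟨fun hb => h.isTwoGroupOfCentralType hG.1 hb, fun h2 => ?_⟩,
    ⟨fun hb => h.isDoublyTransitiveFrobenius hG.1 hb, fun h2 => ?_⟩⟩⟩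
  · rintro ⟨hG, χ, b, h, hb | hb⟩
    · exact Or.inr (h.isDoublyTransitiveFrobenius hG.1 hb)
    · exact Or.inl (h.isTwoGroupOfCentralType hG.1 hb)
  · rintro (hG | hG)
    · obtain ⟨χ, b, h, hb⟩ := hG.exists_columnsDifferOnlyAt
      exact ⟨⟨hG.1, 1, b, χ, h⟩, χ, b, h, Or.inr hb⟩
    · obtain ⟨hG2, χ, b, h, hb⟩ := hG.exists_columnsDifferOnlyAt
      exact ⟨⟨hG2, 1, b, χ, h⟩, χ, b, h, Or.inl hb⟩
  -- The structure of `G` supplies some exceptional pair; uniqueness carries its value over to the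
  -- given one.
  · obtain ⟨χ', b', h', hb'⟩ := h2.exists_columnsDifferOnlyAt
    obtain rfl := h.eq_of_columnsDifferOnlyAt h'
    rw [h.apply_eq h', hb']
  · obtain ⟨-, χ', b', h', hb'⟩ := h2.exists_columnsDifferOnlyAt
    obtain rfl := h.eq_of_columnsDifferOnlyAt h'
    rw [h.apply_eq h', hb']
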